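/- **Theorem 4.1.** Let $G$ be a real Lie group of dimension $r$, let $b_1,\dots,b_r$ be a basis of its Lie algebra, and let $w^1,\dots,w^r$ be the left-invariant one-forms on $G$ which at the identity form the dual basis. Let $C^A_{BC}$ be the structure constants of $G$, with the sign convention $[b_B,b_C]=-\sum_A C^A_{BC}\,b_A$; this is the convention for which $$dw^A=\tfrac12\sum_{B,C} C^A_{BC}\,w^B\wedge w^C ,\qquad A=1,\dots,r. \tag{1}$$ Let $U\subset\mathbb R^N$ be open, with coordinates $X^1,\dots,X^N$, and let $\xi^I_A:U\to\mathbb R$ ($1\le I\le N$, $1\le A\le r$) be smooth functions. Then (1) holds, and if the Lie identities $$\sum_K\xi^K_B\frac{\partial \xi^I_C}{\partial X^K}-\sum_K\xi^K_C\frac{\partial \xi^I_B}{\partial X^K}+\sum_A\xi^I_A\,C^A_{BC}=0$$ hold on $U$ for all $I,B,C$, then the Pfaffian system $dX^I-\sum_A\xi^I_A(X)\,w^A=0$, $I=1,\dots,N$, on $G\times U$ is completely integrable. Here a Pfaffian system is identified with the $C^\infty$-module $R$ of one-forms on $M=G\times U$ spanned by the forms $\theta^I=dX^I-\sum_A\xi^I_A(X)\,w^A$,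 and it is called completely integrable if $R$ consists of smooth forms and $dR\subset F^*(M)\wedge R$, where $F^*(M)$ is the exterior algebra of smooth differential forms on $M$; that is, for every $\theta\in R$ the two-form $d\theta$ is a finite sum $\sum_j\eta_j\wedge\rho_j$ with smooth one-forms $\eta_j$ and with $\rho_j\in R$. -/

import Mathlib

open scoped Manifold ContDiff

noncomputable section

namespace Pfaffian

/-! ### Differential forms of degree one and two on a manifold -/

section Forms

variable {V : Type*} [AddCommGroup V] [Module ℝ V] [TopologicalSpace V]

/-- The wedge product of two linear forms,
`(α ∧ β)(u, v) = α u * β v - α v * β u` (no factor `1 / 2`). -/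
def wedge (α β : V →L[ℝ] ℝ) : V [⋀^Fin 2]→L[ℝ] ℝ where
  toFun v := α (v 0) * β (v 1) - α (v 1) * β (v 0)
  map_update_add' := by
    intro inst v i x y
    have h : inst = instDecidableEqFin 2 := Subsingleton.elim _ _
    subst h
    fin_cases i <;> simp <;> ring
  map_update_smul' := by
    intro inst v i c x
    have h : inst = instDecidableEqFin 2 := Subsingleton.elim _ _
    subst h
    fin_cases i <;> simp <;> ring
  cont := by fun_prop
  map_eq_zero_of_eq' := by
    intro v i j hv hij
    fin_cases i <;> fin_cases j <;> simp_all

theorem wedge_apply (α β : V →L[ℝ] ℝ) (v : Fin 2 → V) :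
    wedge α β v = α (v 0) * β (v 1) - α (v 1) * β (v 0) := rfl

end Forms

section Manifold

variable {E : Type*} [NormedAddCommGroup E] [NormedSpace ℝ E]
  {H : Type*} [TopologicalSpace H] (I : ModelWithCorners ℝ E H)
  (M : Type*) [TopologicalSpace M] [ChartedSpace H M]

/-- A (not necessarily smooth) differential one-form on `M`. -/
abbrev OneForm : Type _ := ∀ x : M, TangentSpace I x →L[ℝ] ℝ

/-- A (not necessarily smooth) differential two-form on `M`. -/
abbrev TwoForm : Type _ := ∀ x : M, TangentSpace I x [⋀^Fin 2]→L[ℝ] ℝ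

variable {I M}

/-- The expression of a one-form in the preferred chart `φ` at `x₀`, i.e. the pull-back of the
form by `φ⁻¹`, a one-form on the model vector space. -/
def inChart (α : OneForm I M) (x₀ : M) (y : E) : E →L[ℝ] ℝ :=
  (α ((extChartAt I x₀).symm y)).comp
    (mfderivWithin 𝓘(ℝ, E) I (extChartAt I x₀).symm (Set.range I) y)

/-- A one-form is smooth if its expression in each chart is smooth. -/
def IsSmooth (α : OneForm I M) : Prop :=
  ∀ x₀ : M, ContDiffOn ℝ ∞ (inChart α x₀) (extChartAt I x₀).target

/-- The exterior derivative of a one-form: at `x`, take the exterior derivative of its expression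
in the preferred chart at `x`, and pull it back to `M` by that chart. -/
def extd (α : OneForm I M) : TwoForm I M := fun x ↦
  ContinuousAlternatingMap.compContinuousLinearMap
    (extDerivWithin
      (fun y ↦ ContinuousAlternatingMap.ofSubsingleton ℝ E ℝ (0 : Fin 1) (inChart α x y))
      (Set.range I) (extChartAt I x x))
    (mfderiv I 𝓘(ℝ, E) (extChartAt I x) x)

/-- The differential `df` of a real function, as a one-form. -/
def differential (f : M → ℝ) : OneForm I M := fun x ↦ mfderiv I 𝓘(ℝ, ℝ) f x

/-- The pull-back `f^* α` of a one-form. -/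
def pullback
    {E' : Type*} [NormedAddCommGroup E'] [NormedSpace ℝ E']
    {H' : Type*} [TopologicalSpace H'] {I' : ModelWithCorners ℝ E' H'}
    {M' : Type*} [TopologicalSpace M'] [ChartedSpace H' M']
    (f : M' → M) (α : OneForm I M) : OneForm I' M' :=
  fun x ↦ (α (f x)).comp (mfderiv I' I f x)

/-! ### Pfaffian systems -/

/-- The Pfaffian system generated by the one-forms `θ i`: the module over the ring of smooth
functions that they span. -/
def pfaffianSystem {ι : Type*} [Fintype ι] (θ : ι → OneForm I M) : Set (OneForm I M) :=
  {ρ | ∃ f : ι → M → ℝ, (∀ i, ContMDiff I 𝓘(ℝ, ℝ) ∞ (f i)) ∧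
    ρ = fun x ↦ ∑ i, f i x • θ i x}

/-- A Pfaffian system `R` on `M` (a set of smooth one-forms) is completely integrable if
`dR ⊂ F^*(M) ∧ R`, where `F^*(M)` is the exterior algebra of smooth differential forms: the
exterior derivative of each member of `R` is a finite sum of products `η ∧ ρ` of a smooth one-form
`η` and a member `ρ` of `R` (these sums make up the degree two part of `F^*(M) ∧ R`). -/
def CompletelyIntegrable (R : Set (OneForm I M)) : Prop :=
  (∀ θ ∈ R, IsSmooth θ) ∧
  ∀ θ ∈ R, ∃ (n : ℕ) (η ρ : Fin n → OneForm I M),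
    (∀ j, IsSmooth (η j)) ∧ (∀ j, ρ j ∈ R) ∧
    ∀ x, extd θ x = ∑ j, wedge (η j x) (ρ j x)

end Manifold

/-! ### Invariant forms of a Lie group and the associated Pfaffian system -/

section LieGroup

variable {E : Type*} [NormedAddCommGroup E] [NormedSpace ℝ E] [FiniteDimensional ℝ E]
  {G : Type*} [TopologicalSpace G] [ChartedSpace E G] [Group G]
  {r N : ℕ}

/-- The coordinate functional `b^A` on the Lie algebra (whose underlying space is `E`). -/
def coordinate (b : Module.Basis (Fin r) ℝ (GroupLieAlgebra 𝓘(ℝ, E) G)) (A : Fin r) : E →L[ℝ] ℝ :=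
  let l : E →ₗ[ℝ] ℝ := b.coord A
  LinearMap.toContinuousLinearMap l

/-- The left-invariant one-forms `w^A` on `G` which at the identity form the basis dual to the
basis `b` of the Lie algebra: `w^A(v) = b^A(d(L_{a⁻¹}) v)` for `v` tangent to `G` at `a`. -/
def invariantForm (b : Module.Basis (Fin r) ℝ (GroupLieAlgebra 𝓘(ℝ, E) G)) (A : Fin r) :
    OneForm 𝓘(ℝ, E) G :=
  fun a ↦ (coordinate b A).comp
    (mfderiv 𝓘(ℝ, E) 𝓘(ℝ, E) (fun c : G ↦ a⁻¹ * c) a)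

/-- The structure constants `C^A_{BC}` of `G` in the basis `b` of its Lie algebra, with the sign
for which the dual left-invariant forms satisfy `dw^A = ½ C^A_{BC} w^B ∧ w^C`; that is,
`[b_B, b_C] = - C^A_{BC} b_A`. -/
def structureConstant (b : Module.Basis (Fin r) ℝ (GroupLieAlgebra 𝓘(ℝ, E) G))
    (A B C : Fin r) : ℝ :=
  -b.repr ⁅b B, b C⁆ A

/-- The partial derivative `∂f/∂X^K` on `ℝ^N`. -/
def partialDeriv (K : Fin N) (f : EuclideanSpace ℝ (Fin N) → ℝ)
    (X : EuclideanSpace ℝ (Fin N)) : ℝ :=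
  fderiv ℝ f X (EuclideanSpace.single K 1)

/-- The one-forms `θ^J = dX^J - ξ^J_A(X) w^A` on `G × U`, where `U` is an open subset of `ℝ^N`
with coordinates `X^J` and the forms `w^A` on `G` are pulled back to `G × U`. -/
def representationForm (b : Module.Basis (Fin r) ℝ (GroupLieAlgebra 𝓘(ℝ, E) G))
    (U : TopologicalSpace.Opens (EuclideanSpace ℝ (Fin N)))
    (ξ : Fin N → Fin r → EuclideanSpace ℝ (Fin N) → ℝ) (J : Fin N) :
    OneForm (𝓘(ℝ, E).prod 𝓘(ℝ, EuclideanSpace ℝ (Fin N))) (G × U) :=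
  fun p ↦ differential (fun q : G × U ↦ (q.2 : EuclideanSpace ℝ (Fin N)) J) p -
    ∑ A, ξ J A (p.2 : EuclideanSpace ℝ (Fin N)) •
      pullback (Prod.fst : G × U → G) (invariantForm b A) p

end LieGroup

end Pfaffian

end

open scoped Manifold ContDiff

noncomputable section

namespace Pfaffian

open Set Filter Topology

set_option linter.unusedSectionVars false

section General

variable {E : Type*} [NormedAddCommGroup E] [NormedSpace ℝ E]
  {H : Type*} [TopologicalSpace H] {I : ModelWithCorners ℝ E H} [I.Boundaryless]
  {M : Type*} [TopologicalSpace M] [ChartedSpace H M] [IsManifold I ∞ M]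

theorem mfderivWithin_extChartAt_symm_eq (x₀ : M) (y : E) :
    mfderivWithin 𝓘(ℝ, E) I (extChartAt I x₀).symm (range I) y =
      mfderiv 𝓘(ℝ, E) I (extChartAt I x₀).symm y := by
  rw [I.range_eq_univ, mfderivWithin_univ]

theorem inChart_apply (α : OneForm I M) (x₀ : M) (y u : E) :
    inChart α x₀ y u =
      α ((extChartAt I x₀).symm y) (mfderiv 𝓘(ℝ, E) I (extChartAt I x₀).symm y u) := by
  rw [← mfderivWithin_extChartAt_symm_eq]
  rfl

theorem mfderiv_extChartAt_self (x : M) :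
    mfderiv I 𝓘(ℝ, E) (extChartAt I x) x = ContinuousLinearMap.id ℝ E := by
  have h : MDifferentiableAt I 𝓘(ℝ, E) (extChartAt I x) x :=
    mdifferentiableAt_extChartAt (mem_chart_source H x)
  have h' : mfderiv I 𝓘(ℝ, E) (extChartAt I x) x = fderivWithin ℝ
      (writtenInExtChartAt I 𝓘(ℝ, E) x (extChartAt I x)) (range I) (extChartAt I x x) := if_pos h
  refine h'.trans ?_
  rw [I.range_eq_univ, fderivWithin_univ]
  have : writtenInExtChartAt I 𝓘(ℝ, E) x (extChartAt I x) =ᶠ[𝓝 (extChartAt I x x)] id := by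
    filter_upwards [extChartAt_target_mem_nhds (I := I) x] with y hy
    exact (extChartAt I x).right_inv hy
  rw [this.fderiv_eq, fderiv_id]

theorem mdifferentiableAt_extChartAt_symm {x₀ : M} {y : E} (hy : y ∈ (extChartAt I x₀).target) :
    MDifferentiableAt 𝓘(ℝ, E) I (extChartAt I x₀).symm y :=
  ((contMDiffOn_extChartAt_symm (n := ∞) x₀).contMDiffAt
    ((isOpen_extChartAt_target x₀).mem_nhds hy)).mdifferentiableAt (by simp)

theorem mfderiv_extChartAt_symm_self (x : M) :
    mfderiv 𝓘(ℝ, E) I (extChartAt I x).symm (extChartAt I x x) = ContinuousLinearMap.id ℝ E := by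
  have h := mfderiv_extChartAt_comp_mfderivWithin_extChartAt_symm (I := I)
    (mem_extChartAt_target x)
  rw [mfderivWithin_extChartAt_symm_eq, extChartAt_to_inv, mfderiv_extChartAt_self] at h
  exact h

theorem IsSmooth.contDiffAt {α : OneForm I M} (hα : IsSmooth α) {x₀ : M} {y : E}
    (hy : y ∈ (extChartAt I x₀).target) : ContDiffAt ℝ ∞ (inChart α x₀) y :=
  (hα x₀).contDiffAt ((isOpen_extChartAt_target x₀).mem_nhds hy)

theorem IsSmooth.differentiableAt {α : OneForm I M} (hα : IsSmooth α) (x : M) :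
    DifferentiableAt ℝ (inChart α x) (extChartAt I x x) :=
  (hα.contDiffAt (mem_extChartAt_target x)).differentiableAt (by simp)

theorem inChart_self (α : OneForm I M) (x : M) :
    inChart α x (extChartAt I x x) = α x := by
  refine ContinuousLinearMap.ext fun (u : E) ↦ ?_
  have h := inChart_apply α x (extChartAt I x x) u
  rw [mfderiv_extChartAt_symm_self, extChartAt_to_inv] at h
  exact h

theorem extd_apply {α : OneForm I M} {x : M}
    (hα : DifferentiableAt ℝ (inChart α x) (extChartAt I x x)) (v : Fin 2 → E) :
    extd α x v = fderiv ℝ (inChart α x) (extChartAt I x x) (v 0) (v 1) -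
      fderiv ℝ (inChart α x) (extChartAt I x x) (v 1) (v 0) := by
  have h : extd α x v = extDeriv
      (fun y ↦ ContinuousAlternatingMap.ofSubsingleton ℝ E ℝ (0 : Fin 1) (inChart α x y))
      (extChartAt I x x) v := by
    rw [extd, I.range_eq_univ, extDerivWithin_univ, mfderiv_extChartAt_self]
    rfl
  rw [h, extDeriv_apply]
  · refine (Fin.sum_univ_two _).trans ?_
    have (w : E) (z : E) : fderiv ℝ (fun y ↦ inChart α x y w) (extChartAt I x x) z =
        fderiv ℝ (inChart α x) (extChartAt I x x) z w := by
      refine (DFunLike.congr_fun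
        (hα.hasFDerivAt.clm_apply (hasFDerivAt_const w _)).fderiv z).trans ?_
      rw [ContinuousLinearMap.comp_zero, zero_add, ContinuousLinearMap.flip_apply]
    have h0 : (fun y ↦ (ContinuousAlternatingMap.ofSubsingleton ℝ E ℝ (0 : Fin 1) (inChart α x y))
        ((0 : Fin 2).removeNth v)) = fun y ↦ inChart α x y (v 1) := rfl
    have h1 : (fun y ↦ (ContinuousAlternatingMap.ofSubsingleton ℝ E ℝ (0 : Fin 1) (inChart α x y))
        ((1 : Fin 2).removeNth v)) = fun y ↦ inChart α x y (v 0) := rfl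
    rw [h0, h1, this, this, Fin.val_zero, Fin.val_one, pow_zero, one_smul, pow_one, neg_one_smul,
      sub_eq_add_neg]
  · exact (ContinuousAlternatingMap.ofSubsingletonLIE (𝕜 := ℝ) (E := E) (F := ℝ)
      (0 : Fin 1)).differentiableAt.comp _ hα

theorem inChart_add (α β : OneForm I M) (x₀ : M) :
    inChart (fun x ↦ α x + β x) x₀ = fun y ↦ inChart α x₀ y + inChart β x₀ y := rfl

theorem inChart_smul (f : M → ℝ) (α : OneForm I M) (x₀ : M) :
    inChart (fun x ↦ f x • α x) x₀ =
      fun y ↦ f ((extChartAt I x₀).symm y) • inChart α x₀ y := rfl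

theorem inChart_sum {ι : Type*} (s : Finset ι) (α : ι → OneForm I M) (x₀ : M) :
    inChart (fun x ↦ ∑ i ∈ s, α i x) x₀ = fun y ↦ ∑ i ∈ s, inChart (α i) x₀ y := by
  funext y
  ext u
  simp only [inChart_apply, _root_.sum_apply]

theorem contDiffOn_comp_extChartAt_symm {f : M → ℝ} (hf : ContMDiff I 𝓘(ℝ, ℝ) ∞ f) (x₀ : M) :
    ContDiffOn ℝ ∞ (fun y ↦ f ((extChartAt I x₀).symm y)) (extChartAt I x₀).target :=
  contMDiffOn_iff_contDiffOn.mp (hf.comp_contMDiffOn (contMDiffOn_extChartAt_symm x₀))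

theorem IsSmooth.add {α β : OneForm I M} (hα : IsSmooth α) (hβ : IsSmooth β) :
    IsSmooth (fun x ↦ α x + β x) := fun x₀ ↦ (hα x₀).add (hβ x₀)

theorem IsSmooth.smul {f : M → ℝ} {α : OneForm I M} (hf : ContMDiff I 𝓘(ℝ, ℝ) ∞ f)
    (hα : IsSmooth α) : IsSmooth (fun x ↦ f x • α x) :=
  fun x₀ ↦ (contDiffOn_comp_extChartAt_symm hf x₀).smul (hα x₀)

theorem IsSmooth.sum {ι : Type*} {s : Finset ι} {α : ι → OneForm I M}
    (hα : ∀ i ∈ s, IsSmooth (α i)) : IsSmooth (fun x ↦ ∑ i ∈ s, α i x) := fun x₀ ↦ by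
  rw [inChart_sum]
  exact ContDiffOn.sum fun i hi ↦ hα i hi x₀

theorem inChart_differential {f : M → ℝ} (hf : ContMDiff I 𝓘(ℝ, ℝ) ∞ f) {x₀ : M} {y : E}
    (hy : y ∈ (extChartAt I x₀).target) :
    inChart (differential (I := I) f) x₀ y =
      fderiv ℝ (fun z ↦ f ((extChartAt I x₀).symm z)) y := by
  ext u
  rw [inChart_apply, differential, ← mfderiv_eq_fderiv,
    show (fun z ↦ f ((extChartAt I x₀).symm z)) = f ∘ (extChartAt I x₀).symm from rfl,
    mfderiv_comp y (hf.mdifferentiableAt (by simp)) (mdifferentiableAt_extChartAt_symm hy)]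
  rfl

theorem isSmooth_differential {f : M → ℝ} (hf : ContMDiff I 𝓘(ℝ, ℝ) ∞ f) :
    IsSmooth (differential (I := I) f) := fun x₀ ↦
  ((contDiffOn_comp_extChartAt_symm hf x₀).fderiv_of_isOpen (isOpen_extChartAt_target x₀)
    (by simp)).congr fun _ hy ↦ inChart_differential hf hy

theorem differential_apply {f : M → ℝ} (hf : ContMDiff I 𝓘(ℝ, ℝ) ∞ f) (x : M) :
    differential (I := I) f x =
      fderiv ℝ (fun z ↦ f ((extChartAt I x).symm z)) (extChartAt I x x) := by
  exact (inChart_self _ x).symm.trans (inChart_differential hf (mem_extChartAt_target x))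

theorem extd_add {α β : OneForm I M} (hα : IsSmooth α) (hβ : IsSmooth β) (x : M) :
    extd (fun x ↦ α x + β x) x = extd α x + extd β x := by
  refine ContinuousAlternatingMap.ext fun (v : Fin 2 → E) ↦ ?_
  have := extd_apply ((hα.add hβ).differentiableAt x) v
  rw [inChart_add, fderiv_fun_add (hα.differentiableAt x) (hβ.differentiableAt x)] at this
  rw [this]
  change _ = extd α x v + extd β x v
  rw [extd_apply (hα.differentiableAt x), extd_apply (hβ.differentiableAt x)]
  simp only [_root_.add_apply]
  ring

theorem extd_smul {f : M → ℝ} {α : OneForm I M} (hf : ContMDiff I 𝓘(ℝ, ℝ) ∞ f)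
    (hα : IsSmooth α) (x : M) :
    extd (fun x ↦ f x • α x) x =
      wedge (differential (I := I) f x) (α x) + f x • extd α x := by
  refine ContinuousAlternatingMap.ext fun (v : Fin 2 → E) ↦ ?_
  have := extd_apply ((hα.smul hf).differentiableAt x) v
  have hf' : DifferentiableAt ℝ (fun z ↦ f ((extChartAt I x).symm z)) (extChartAt I x x) :=
    ((contDiffOn_comp_extChartAt_symm hf x).contDiffAt
      (extChartAt_target_mem_nhds x)).differentiableAt (by simp)
  rw [inChart_smul, fderiv_fun_smul hf' (hα.differentiableAt x), extChartAt_to_inv] at this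
  rw [this]
  change _ = wedge (differential (I := I) f x) (α x) v + f x * extd α x v
  rw [extd_apply (hα.differentiableAt x)]
  have hw : wedge (differential (I := I) f x) (α x) v =
      fderiv ℝ (fun z ↦ f ((extChartAt I x).symm z)) (extChartAt I x x) (v 0) *
        inChart α x (extChartAt I x x) (v 1) -
      fderiv ℝ (fun z ↦ f ((extChartAt I x).symm z)) (extChartAt I x x) (v 1) *
        inChart α x (extChartAt I x x) (v 0) := by
    refine (wedge_apply _ _ _).trans ?_
    rw [inChart_self, differential_apply hf]
    rfl
  rw [hw]
  simp only [_root_.add_apply, _root_.smul_apply,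
    ContinuousLinearMap.smulRight_apply, smul_eq_mul]
  ring

theorem extd_sum {ι : Type*} {s : Finset ι} {α : ι → OneForm I M}
    (hα : ∀ i ∈ s, IsSmooth (α i)) (x : M) :
    extd (fun x ↦ ∑ i ∈ s, α i x) x = ∑ i ∈ s, extd (α i) x := by
  refine ContinuousAlternatingMap.ext fun (v : Fin 2 → E) ↦ ?_
  have := extd_apply ((IsSmooth.sum hα).differentiableAt x) v
  rw [inChart_sum, fderiv_fun_sum fun i hi ↦ (hα i hi).differentiableAt x] at this
  refine this.trans (Eq.trans ?_ (ContinuousAlternatingMap.sum_apply _ _).symm)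
  refine Eq.trans ?_ (Finset.sum_congr rfl fun i hi ↦
    (extd_apply ((hα i hi).differentiableAt x) v).symm)
  simp only [_root_.sum_apply, ← Finset.sum_sub_distrib]

theorem extd_differential {f : M → ℝ} (hf : ContMDiff I 𝓘(ℝ, ℝ) ∞ f) (x : M) :
    extd (differential (I := I) f) x = 0 := by
  refine ContinuousAlternatingMap.ext fun (v : Fin 2 → E) ↦ ?_
  rw [extd_apply ((isSmooth_differential hf).differentiableAt x)]
  have : inChart (differential (I := I) f) x =ᶠ[𝓝 (extChartAt I x x)]
      fderiv ℝ (fun z ↦ f ((extChartAt I x).symm z)) := by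
    filter_upwards [extChartAt_target_mem_nhds (I := I) x] with y hy
    exact inChart_differential hf hy
  rw [this.fderiv_eq]
  have hs := ((contDiffOn_comp_extChartAt_symm hf x).contDiffAt
      (extChartAt_target_mem_nhds x)).isSymmSndFDerivAt
    (by simpa using (WithTop.coe_le_coe.mpr le_top : ((2 : ℕ∞) : WithTop ℕ∞) ≤ ∞))
  rw [hs.eq (v 0) (v 1), sub_self]
  rfl

end General

section Product

variable {E : Type*} [NormedAddCommGroup E] [NormedSpace ℝ E]
  {H : Type*} [TopologicalSpace H] {I : ModelWithCorners ℝ E H} [I.Boundaryless]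
  {M : Type*} [TopologicalSpace M] [ChartedSpace H M] [IsManifold I ∞ M]
  {E' : Type*} [NormedAddCommGroup E'] [NormedSpace ℝ E']
  {H' : Type*} [TopologicalSpace H'] {I' : ModelWithCorners ℝ E' H'} [I'.Boundaryless]
  {M' : Type*} [TopologicalSpace M'] [ChartedSpace H' M'] [IsManifold I' ∞ M']

theorem inChart_pullback_fst (α : OneForm I M) {p₀ : M × M'} {y : E × E'}
    (hy : y ∈ (extChartAt (I.prod I') p₀).target) :
    inChart (pullback (I' := I.prod I') (Prod.fst : M × M' → M) α) p₀ y =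
      (inChart α p₀.1 y.1).comp (ContinuousLinearMap.fst ℝ E E') := by
  have hy1 : y.1 ∈ (extChartAt I p₀.1).target := by
    rw [extChartAt_prod] at hy
    exact hy.1
  have hs : ((extChartAt (I.prod I') p₀).symm y).1 = (extChartAt I p₀.1).symm y.1 := by
    rw [extChartAt_prod]; rfl
  have key : (mfderiv (I.prod I') I Prod.fst ((extChartAt (I.prod I') p₀).symm y)).comp
      (mfderiv 𝓘(ℝ, E × E') (I.prod I') (extChartAt (I.prod I') p₀).symm y) =
      (mfderiv 𝓘(ℝ, E) I (extChartAt I p₀.1).symm y.1).comp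
        (ContinuousLinearMap.fst ℝ E E') := by
    have h2 : mfderiv 𝓘(ℝ, E × E') 𝓘(ℝ, E) (Prod.fst : E × E' → E) y =
        ContinuousLinearMap.fst ℝ E E' :=
      mfderiv_eq_fderiv.trans fderiv_fst
    have h3 := mfderiv_comp (I'' := I) y
      (mdifferentiableAt_extChartAt_symm (I := I) (x₀ := p₀.1) (y := y.1) hy1)
      (differentiableAt_fst (𝕜 := ℝ)).mdifferentiableAt
    have h4 := mfderiv_comp (I'' := I) y
      (mdifferentiableAt_fst (x := (extChartAt (I.prod I') p₀).symm y))
      (mdifferentiableAt_extChartAt_symm hy)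
    have h5 : (Prod.fst : M × M' → M) ∘ (extChartAt (I.prod I') p₀).symm =
        (extChartAt I p₀.1).symm ∘ Prod.fst := by
      rw [extChartAt_prod]
      rfl
    rw [h5] at h4
    rw [h2] at h3
    exact h4.symm.trans h3
  refine ContinuousLinearMap.ext fun (u : E × E') ↦ ?_
  rw [inChart_apply]
  refine (congrArg (α _) (DFunLike.congr_fun key u)).trans ?_
  refine Eq.trans ?_ (inChart_apply α p₀.1 y.1 u.1).symm
  exact congrArg (fun a ↦ α a (mfderiv 𝓘(ℝ, E) I (extChartAt I p₀.1).symm y.1 u.1)) hs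

theorem isSmooth_pullback_fst {α : OneForm I M} (hα : IsSmooth α) :
    IsSmooth (pullback (I' := I.prod I') (Prod.fst : M × M' → M) α) := fun p₀ ↦ by
  have h : ContDiffOn ℝ ∞ (fun y : E × E' ↦ (inChart α p₀.1 y.1).comp
      (ContinuousLinearMap.fst ℝ E E')) (extChartAt (I.prod I') p₀).target := by
    refine ContDiffOn.clm_comp ?_ contDiffOn_const
    refine (hα p₀.1).comp contDiffOn_fst fun y hy ↦ ?_
    rw [extChartAt_prod] at hy
    exact hy.1
  exact h.congr fun y hy ↦ inChart_pullback_fst α hy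

theorem extd_pullback_fst {α : OneForm I M} (hα : IsSmooth α) (p : M × M') (v : Fin 2 → E × E') :
    extd (pullback (I' := I.prod I') (Prod.fst : M × M' → M) α) p v =
      extd α p.1 (fun i ↦ (v i).1) := by
  have hd := (isSmooth_pullback_fst (I' := I') (M' := M') hα).differentiableAt p
  rw [extd_apply hd, extd_apply (hα.differentiableAt p.1)]
  have : inChart (pullback (I' := I.prod I') (Prod.fst : M × M' → M) α) p
      =ᶠ[𝓝 (extChartAt (I.prod I') p p)]
      fun y ↦ (inChart α p.1 y.1).comp (ContinuousLinearMap.fst ℝ E E') := by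
    filter_upwards [extChartAt_target_mem_nhds (I := I.prod I') p] with y hy
    exact inChart_pullback_fst α hy
  have hp : (extChartAt (I.prod I') p p).1 = extChartAt I p.1 p.1 := by
    rw [extChartAt_prod]; rfl
  have h1 : HasFDerivAt (fun y : E × E' ↦ inChart α p.1 y.1)
      ((fderiv ℝ (inChart α p.1) (extChartAt I p.1 p.1)).comp (ContinuousLinearMap.fst ℝ E E'))
      (extChartAt (I.prod I') p p) := by
    have := (hα.differentiableAt p.1).hasFDerivAt
    rw [← hp] at this ⊢
    exact this.comp _ hasFDerivAt_fst
  rw [this.fderiv_eq, (h1.clm_comp (hasFDerivAt_const _ _)).fderiv]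
  simp

end Product

theorem half_smul_sum_smul_apply {V : Type*} [AddCommGroup V] [Module ℝ V] [TopologicalSpace V]
    {ι : Type*} [Fintype ι] (c : ι → ι → ℝ) (η : ι → ι → V [⋀^Fin 2]→L[ℝ] ℝ) (v : Fin 2 → V) :
    ((1 / 2 : ℝ) • ∑ i, ∑ j, c i j • η i j) v = (1 / 2 : ℝ) * ∑ i, ∑ j, c i j * η i j v := by
  simp only [ContinuousAlternatingMap.smul_apply, ContinuousAlternatingMap.sum_apply, smul_eq_mul]

section Invariant

open VectorField

variable {E : Type*} [NormedAddCommGroup E] [NormedSpace ℝ E] [FiniteDimensional ℝ E]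
  {G : Type*} [TopologicalSpace G] [ChartedSpace E G] [Group G] [LieGroup 𝓘(ℝ, E) ∞ G]
  {r : ℕ} (b : Module.Basis (Fin r) ℝ (GroupLieAlgebra 𝓘(ℝ, E) G))

variable (E G) in
theorem lieGroup_minSmoothness : LieGroup 𝓘(ℝ, E) (minSmoothness ℝ 3) G :=
  LieGroup.of_le (n := ∞)
    (by simpa using (WithTop.coe_le_coe.mpr le_top : ((3 : ℕ∞) : WithTop ℕ∞) ≤ ∞))

theorem mdifferentiableAt_mul_left_const (g c : G) :
    MDifferentiableAt 𝓘(ℝ, E) 𝓘(ℝ, E) (fun c : G ↦ g * c) c :=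
  (contMDiff_mul_left (n := ∞)).contMDiffAt.mdifferentiableAt (by simp)

theorem mfderiv_extChartAt_of_eq {x y : G} (h : y = x) :
    (mfderiv 𝓘(ℝ, E) 𝓘(ℝ, E) (extChartAt 𝓘(ℝ, E) x) y : E → E) = id := by
  subst h
  rw [mfderiv_extChartAt_self]
  rfl

theorem inChart_invariantForm (A : Fin r) {x₀ : G} {y : E}
    (hy : y ∈ (extChartAt 𝓘(ℝ, E) x₀).target) :
    inChart (invariantForm b A) x₀ y = (coordinate b A).comp
      (fderiv ℝ (fun z ↦ extChartAt 𝓘(ℝ, E) (1 : G)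
        (((extChartAt 𝓘(ℝ, E) x₀).symm y)⁻¹ * (extChartAt 𝓘(ℝ, E) x₀).symm z)) y) := by
  set φ := extChartAt 𝓘(ℝ, E) x₀
  set a := φ.symm y
  have h1 : MDifferentiableAt 𝓘(ℝ, E) 𝓘(ℝ, E) φ.symm y := mdifferentiableAt_extChartAt_symm hy
  have h2 := mdifferentiableAt_mul_left_const (E := E) a⁻¹ a
  have h3 : MDifferentiableAt 𝓘(ℝ, E) 𝓘(ℝ, E) (extChartAt 𝓘(ℝ, E) (1 : G)) (a⁻¹ * a) := by
    rw [inv_mul_cancel]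
    exact mdifferentiableAt_extChartAt (mem_chart_source E _)
  have h4 := mfderiv_comp a h3 h2
  have h5 := mfderiv_comp y (h3.comp a h2) h1
  refine ContinuousLinearMap.ext fun (u : E) ↦ ?_
  rw [inChart_apply]
  have h6 : ∀ w : E, (mfderiv 𝓘(ℝ, E) 𝓘(ℝ, E) (extChartAt 𝓘(ℝ, E) (1 : G)) (a⁻¹ * a) w : E) = w :=
    fun w ↦ congrFun (mfderiv_extChartAt_of_eq (E := E) (G := G) (inv_mul_cancel a)) w
  have h7 := DFunLike.congr_fun h4 (mfderiv 𝓘(ℝ, E) 𝓘(ℝ, E) φ.symm y u)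
  have h8 : ((mfderiv 𝓘(ℝ, E) 𝓘(ℝ, E) (extChartAt 𝓘(ℝ, E) (1 : G) ∘ fun c ↦ a⁻¹ * c) a)
      (mfderiv 𝓘(ℝ, E) 𝓘(ℝ, E) φ.symm y u) : E) = fderiv ℝ (fun z ↦ extChartAt 𝓘(ℝ, E) (1 : G)
        (a⁻¹ * φ.symm z)) y u := DFunLike.congr_fun (h5.symm.trans (mfderiv_eq_fderiv (E := E) (E' := E)
    (f := fun z ↦ extChartAt 𝓘(ℝ, E) (1 : G) (a⁻¹ * φ.symm z)))) u
  exact congrArg (coordinate b A) ((((h6 _).symm.trans h7.symm).trans h8 :))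

theorem isSmooth_invariantForm (A : Fin r) : IsSmooth (invariantForm b A) := fun x₀ ↦ by
  set φ := extChartAt 𝓘(ℝ, E) x₀
  suffices h : ContDiffOn ℝ ∞ (fun y ↦ fderiv ℝ (fun z ↦ extChartAt 𝓘(ℝ, E) (1 : G)
      ((φ.symm y)⁻¹ * φ.symm z)) y) φ.target from
    (contDiffOn_const.clm_comp h).congr fun y hy ↦ inChart_invariantForm b A hy
  intro y hy
  have hsymm : ContMDiffAt 𝓘(ℝ, E) 𝓘(ℝ, E) ∞ φ.symm y :=
    (contMDiffOn_extChartAt_symm x₀).contMDiffAt ((isOpen_extChartAt_target x₀).mem_nhds hy)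
  have h1 : ContMDiffAt 𝓘(ℝ, E × E) 𝓘(ℝ, E) ∞ (fun p : E × E ↦ φ.symm p.1) (y, y) :=
    ContMDiffAt.comp (y, y) (g := φ.symm) (f := Prod.fst) hsymm contDiff_fst.contMDiff.contMDiffAt
  have h2 : ContMDiffAt 𝓘(ℝ, E × E) 𝓘(ℝ, E) ∞ (fun p : E × E ↦ φ.symm p.2) (y, y) :=
    ContMDiffAt.comp (y, y) (g := φ.symm) (f := Prod.snd) hsymm contDiff_snd.contMDiff.contMDiffAt
  have h3 : ContMDiffAt 𝓘(ℝ, E) 𝓘(ℝ, E) ∞ (extChartAt 𝓘(ℝ, E) (1 : G))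
      ((φ.symm y)⁻¹ * φ.symm y) := by
    rw [inv_mul_cancel]
    exact contMDiffAt_extChartAt
  have h4 := ContMDiffAt.comp (y, y) (f := fun p : E × E ↦ (φ.symm p.1)⁻¹ * φ.symm p.2)
    h3 (h1.inv.mul h2)
  exact (ContDiffAt.fderiv (f := fun y z ↦ extChartAt 𝓘(ℝ, E) (1 : G) ((φ.symm y)⁻¹ * φ.symm z))
    (g := id) h4.contDiffAt contDiffAt_id (by simp)).contDiffWithinAt

theorem invariantForm_mulInvariantVectorField (A : Fin r) (v : GroupLieAlgebra 𝓘(ℝ, E) G)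
    (g : G) : invariantForm b A g (mulInvariantVectorField v g) = b.repr v A := by
  have h1 : MDifferentiableAt 𝓘(ℝ, E) 𝓘(ℝ, E) (fun c : G ↦ g⁻¹ * c) (g * 1) :=
    mdifferentiableAt_mul_left_const _ _
  have h2 := mfderiv_comp (1 : G) h1 (mdifferentiableAt_mul_left_const g 1)
  have h3 : (fun c : G ↦ g⁻¹ * c) ∘ (fun c ↦ g * c) = id := by ext x; simp
  rw [h3, mfderiv_id] at h2
  have h4 : ∀ g' : G, g' = g → ∀ u : E,
      (mfderiv 𝓘(ℝ, E) 𝓘(ℝ, E) (fun c : G ↦ g⁻¹ * c) g' u : E) =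
      mfderiv 𝓘(ℝ, E) 𝓘(ℝ, E) (fun c : G ↦ g⁻¹ * c) g u := by
    rintro _ rfl u; rfl
  have h5 := (DFunLike.congr_fun h2 v).trans (h4 _ (mul_one g) _)
  exact congrArg (coordinate b A) h5.symm

theorem exists_mulInvariantVectorField_eq (g : G) (u : TangentSpace 𝓘(ℝ, E) g) :
    ∃ v : GroupLieAlgebra 𝓘(ℝ, E) G, mulInvariantVectorField v g = u := by
  have h1 : MDifferentiableAt 𝓘(ℝ, E) 𝓘(ℝ, E) (fun c : G ↦ g * c) (g⁻¹ * g) :=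
    mdifferentiableAt_mul_left_const _ _
  have h2 := mfderiv_comp g h1 (mdifferentiableAt_mul_left_const g⁻¹ g)
  have h3 : (fun c : G ↦ g * c) ∘ (fun c ↦ g⁻¹ * c) = id := by ext x; simp
  rw [h3, mfderiv_id] at h2
  have h4 : ∀ g' : G, g' = 1 → ∀ u : E,
      (mfderiv 𝓘(ℝ, E) 𝓘(ℝ, E) (fun c : G ↦ g * c) g' u : E) =
      mfderiv 𝓘(ℝ, E) 𝓘(ℝ, E) (fun c : G ↦ g * c) 1 u := by
    rintro _ rfl u; rfl
  exact ⟨mfderiv 𝓘(ℝ, E) 𝓘(ℝ, E) (fun c : G ↦ g⁻¹ * c) g u,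
    ((DFunLike.congr_fun h2 u).trans (h4 _ (inv_mul_cancel g) _)).symm⟩

theorem extd_apply_of_const {α : OneForm 𝓘(ℝ, E) G} (hα : IsSmooth α)
    {V W : Π x : G, TangentSpace 𝓘(ℝ, E) x} {c d : ℝ} (hV : ∀ x, α x (V x) = c)
    (hW : ∀ x, α x (W x) = d) {a : G}
    (hVd : MDifferentiableAt 𝓘(ℝ, E) 𝓘(ℝ, E).tangent
      (fun x ↦ (V x : TangentBundle 𝓘(ℝ, E) G)) a)
    (hWd : MDifferentiableAt 𝓘(ℝ, E) 𝓘(ℝ, E).tangent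
      (fun x ↦ (W x : TangentBundle 𝓘(ℝ, E) G)) a) :
    extd α a ![V a, W a] = -α a (mlieBracket 𝓘(ℝ, E) V W a) := by
  have hG2 : IsManifold 𝓘(ℝ, E) 2 G := IsManifold.of_le (n := ∞)
    (by simpa using (WithTop.coe_le_coe.mpr le_top : ((2 : ℕ∞) : WithTop ℕ∞) ≤ ∞))
  have := FiniteDimensional.complete ℝ E
  set φ := extChartAt 𝓘(ℝ, E) a
  let pb (V : Π x : G, TangentSpace 𝓘(ℝ, E) x) : E → E :=
    mpullbackWithin 𝓘(ℝ, E) 𝓘(ℝ, E) φ.symm V (range 𝓘(ℝ, E))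
  have hpb (V : Π x : G, TangentSpace 𝓘(ℝ, E) x) (hVd : MDifferentiableAt 𝓘(ℝ, E) 𝓘(ℝ, E).tangent
      (fun x ↦ (V x : TangentBundle 𝓘(ℝ, E) G)) a) : DifferentiableAt ℝ (pb V) (φ a) := by
    have := hVd.mdifferentiableWithinAt (s := univ)
      |>.differentiableWithinAt_mpullbackWithin_vectorField
    have hs : φ.symm ⁻¹' univ ∩ range 𝓘(ℝ, E) = univ := by
      rw [preimage_univ, univ_inter, 𝓘(ℝ, E).range_eq_univ]
    exact differentiableWithinAt_univ.mp (hs ▸ this : DifferentiableWithinAt ℝ (pb V) univ (φ a))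
  have hinv : (mfderiv 𝓘(ℝ, E) 𝓘(ℝ, E) φ a).inverse = ContinuousLinearMap.id ℝ E := by
    rw [mfderiv_extChartAt_self]
    exact ContinuousLinearMap.inverse_id
  have hpb0 (V : Π x : G, TangentSpace 𝓘(ℝ, E) x) : pb V (φ a) = V a := by
    have h1 : (mfderivWithin 𝓘(ℝ, E) 𝓘(ℝ, E) φ.symm (range 𝓘(ℝ, E)) (φ a)).inverse =
        ContinuousLinearMap.id ℝ E := by
      rw [mfderivWithin_extChartAt_symm_eq, mfderiv_extChartAt_symm_self]
      exact ContinuousLinearMap.inverse_id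
    have h2 : ∀ x : G, x = a → (V x : E) = V a := by rintro _ rfl; rfl
    exact (DFunLike.congr_fun h1 _).trans (h2 _ (extChartAt_to_inv a))
  have hconst (V : Π x : G, TangentSpace 𝓘(ℝ, E) x) (c : ℝ) (hV : ∀ x, α x (V x) = c)
      (hVd : MDifferentiableAt 𝓘(ℝ, E) 𝓘(ℝ, E).tangent
      (fun x ↦ (V x : TangentBundle 𝓘(ℝ, E) G)) a) (u : E) :
      fderiv ℝ (inChart α a) (φ a) u (V a) = -α a (fderiv ℝ (pb V) (φ a) u) := by
    have h1 : (fun y ↦ inChart α a y (pb V y)) =ᶠ[𝓝 (φ a)] fun _ ↦ c := by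
      filter_upwards [extChartAt_target_mem_nhds (I := 𝓘(ℝ, E)) a] with y hy
      refine Eq.trans (congrArg (α (φ.symm y)) ?_) (hV (φ.symm y))
      exact (isInvertible_mfderivWithin_extChartAt_symm hy).self_apply_inverse _
    have h2 := ((hα.differentiableAt a).hasFDerivAt.clm_apply (hpb V hVd).hasFDerivAt).fderiv
    rw [h1.fderiv_eq, fderiv_fun_const] at h2
    have h3 := DFunLike.congr_fun h2 u
    rw [hpb0, inChart_self] at h3
    exact eq_neg_of_add_eq_zero_right h3.symm
  have hbr : mlieBracket 𝓘(ℝ, E) V W a = lieBracket ℝ (pb V) (pb W) (φ a) := by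
    have hs : φ.symm ⁻¹' univ ∩ range 𝓘(ℝ, E) = univ := by
      rw [preimage_univ, univ_inter, 𝓘(ℝ, E).range_eq_univ]
    have h1 : mlieBracket 𝓘(ℝ, E) V W a = lieBracketWithin ℝ (pb V) (pb W)
        (φ.symm ⁻¹' univ ∩ range 𝓘(ℝ, E)) (φ a) := DFunLike.congr_fun hinv _
    rw [h1, hs, lieBracketWithin_univ]
  have h0 := extd_apply (hα.differentiableAt a) ![V a, W a]
  refine h0.trans ?_
  have h1 := hconst W d hW hWd (V a)
  have h2 := hconst V c hV hVd (W a)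
  refine (congrArg₂ (· - ·) h1 h2).trans ?_
  rw [hbr, lieBracket, hpb0, hpb0]
  have h3 : ∀ (l : E →L[ℝ] ℝ) (x y : E), -l x - -l y = -l (x - y) := fun l x y ↦ by
    rw [map_sub]
    ring
  exact h3 (α a) _ _

theorem extd_invariantForm_mulInvariantVectorField (A : Fin r)
    (v w : GroupLieAlgebra 𝓘(ℝ, E) G) (a : G) :
    extd (invariantForm b A) a ![mulInvariantVectorField v a, mulInvariantVectorField w a] =
      -b.repr ⁅v, w⁆ A := by
  have := lieGroup_minSmoothness E G
  have := FiniteDimensional.complete ℝ E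
  rw [extd_apply_of_const (isSmooth_invariantForm b A)
    (invariantForm_mulInvariantVectorField b A v) (invariantForm_mulInvariantVectorField b A w)
    (mdifferentiableAt_mulInvariantVectorField v) (mdifferentiableAt_mulInvariantVectorField w),
    ← mulInvariantVector_mlieBracket, invariantForm_mulInvariantVectorField]
  rfl

theorem repr_lie (A : Fin r) (v w : GroupLieAlgebra 𝓘(ℝ, E) G) :
    b.repr ⁅v, w⁆ A = ∑ B, ∑ C, b.repr v B * b.repr w C * b.repr ⁅b B, b C⁆ A := by
  have := lieGroup_minSmoothness E G
  have := FiniteDimensional.complete ℝ E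
  conv_lhs => rw [← b.sum_repr v, ← b.sum_repr w, _root_.sum_lie_sum]
  simp only [smul_lie, lie_smul, map_sum, map_smul, Finsupp.coe_finsetSum, Finset.sum_apply,
    Finsupp.smul_apply, smul_eq_mul, mul_assoc, mul_left_comm]

theorem extd_invariantForm (A : Fin r) (a : G) :
    extd (invariantForm b A) a = (1 / 2 : ℝ) • ∑ B, ∑ C, structureConstant b A B C •
      wedge (invariantForm b B a) (invariantForm b C a) := by
  refine ContinuousAlternatingMap.ext fun u ↦ ?_
  obtain ⟨v, hv⟩ := exists_mulInvariantVectorField_eq a (u 0)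
  obtain ⟨w, hw⟩ := exists_mulInvariantVectorField_eq a (u 1)
  have hu : u = ![mulInvariantVectorField v a, mulInvariantVectorField w a] := by
    rw [hv, hw]
    ext i
    fin_cases i <;> rfl
  rw [hu, extd_invariantForm_mulInvariantVectorField]
  have hL := lieGroup_minSmoothness E G
  have := FiniteDimensional.complete ℝ E
  have hskew : b.repr ⁅w, v⁆ A = -b.repr ⁅v, w⁆ A := by
    rw [← lie_skew, map_neg, Finsupp.neg_apply]
  have h1 := repr_lie b A v w
  have h2 := repr_lie b A w v
  refine Eq.trans ?_ (half_smul_sum_smul_apply _ _ _).symm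
  have h3 : ∀ B C : Fin r, structureConstant b A B C *
      wedge (invariantForm b B a) (invariantForm b C a)
        ![mulInvariantVectorField v a, mulInvariantVectorField w a] =
      b.repr w B * b.repr v C * b.repr ⁅b B, b C⁆ A -
        b.repr v B * b.repr w C * b.repr ⁅b B, b C⁆ A := fun B C ↦ by
    rw [wedge_apply, Matrix.cons_val_zero, Matrix.cons_val_one, Matrix.cons_val_zero,
      invariantForm_mulInvariantVectorField, invariantForm_mulInvariantVectorField,
      invariantForm_mulInvariantVectorField, invariantForm_mulInvariantVectorField,
      structureConstant]
    ring
  simp only [h3, Finset.sum_sub_distrib]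
  rw [← h1, ← h2, hskew]
  ring

end Invariant

section Wedge

variable {V : Type*} [AddCommGroup V] [Module ℝ V] [TopologicalSpace V] [IsTopologicalAddGroup V]
  [ContinuousConstSMul ℝ V]

theorem wedge_add_left (α β γ : V →L[ℝ] ℝ) : wedge (α + β) γ = wedge α γ + wedge β γ := by
  ext v
  simp only [wedge_apply, ContinuousAlternatingMap.add_apply, _root_.add_apply]
  ring

theorem wedge_smul_left (c : ℝ) (α β : V →L[ℝ] ℝ) : wedge (c • α) β = c • wedge α β := by
  ext v
  simp only [wedge_apply, ContinuousAlternatingMap.smul_apply, _root_.smul_apply, smul_eq_mul]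
  ring

theorem wedge_sum_left {ι : Type*} (s : Finset ι) (α : ι → V →L[ℝ] ℝ) (β : V →L[ℝ] ℝ) :
    wedge (∑ i ∈ s, α i) β = ∑ i ∈ s, wedge (α i) β := by
  ext v
  simp only [wedge_apply, ContinuousAlternatingMap.sum_apply, _root_.sum_apply, Finset.sum_mul,
    Finset.sum_sub_distrib]

theorem sub_sum_smul {ι : Type*} [Fintype ι] (α : V →L[ℝ] ℝ) (c : ι → ℝ) (β : ι → V →L[ℝ] ℝ) :
    α - ∑ i, c i • β i = α + ∑ i, (-c i) • β i := by
  ext u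
  simp only [_root_.sub_apply, _root_.add_apply, _root_.sum_apply, _root_.smul_apply, smul_eq_mul,
    neg_mul, Finset.sum_neg_distrib]
  exact sub_eq_add_neg _ _

theorem sum_wedge_add_smul {κ : Type*} [Fintype κ] (df θ : κ → V →L[ℝ] ℝ) (f : κ → ℝ)
    (η : κ → κ → V →L[ℝ] ℝ) :
    ∑ J, (wedge (df J) (θ J) + f J • ∑ K, wedge (η J K) (θ K)) =
      ∑ K, wedge (df K + ∑ J, f J • η J K) (θ K) := by
  simp only [wedge_add_left, wedge_sum_left, wedge_smul_left, Finset.sum_add_distrib,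
    Finset.smul_sum]
  rw [add_right_inj, Finset.sum_comm]

/-- The linear algebra behind the integrability of `dX - ξ w`: modulo the forms
`θ K = dX K - ∑ B, ξ K B • w B`, the form `-dξ ∧ w - ξ dw` vanishes. -/
theorem sum_wedge_sub_eq {ι κ : Type*} [Fintype ι] [Fintype κ] (dX θ : κ → V →L[ℝ] ℝ)
    (w df : ι → V →L[ℝ] ℝ) (g : ι → ℝ) (ξ P : κ → ι → ℝ) (c : ι → ι → ι → ℝ)
    (dw : ι → V [⋀^Fin 2]→L[ℝ] ℝ)
    (hθ : ∀ K, θ K = dX K - ∑ B, ξ K B • w B) (hdf : ∀ A, df A = ∑ K, P K A • dX K)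
    (hdw : ∀ A, dw A = (1 / 2 : ℝ) • ∑ B, ∑ C, c A B C • wedge (w B) (w C))
    (hc : ∀ B C, ∑ K, ξ K B * P K C - ∑ K, ξ K C * P K B + ∑ A, g A * c A B C = 0) :
    ∑ A, (wedge (-df A) (w A) + (-g A) • dw A) = ∑ K, wedge (∑ A, P K A • w A) (θ K) := by
  ext v
  have h1 : (∑ A, (wedge (-df A) (w A) + (-g A) • dw A)) v =
      -∑ A, (df A (v 0) * w A (v 1) - df A (v 1) * w A (v 0)) -
        ∑ A, g A * ((1 / 2 : ℝ) * ∑ B, ∑ C, c A B C * (w B (v 0) * w C (v 1) -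
          w B (v 1) * w C (v 0))) := by
    simp only [hdw, ContinuousAlternatingMap.sum_apply, ContinuousAlternatingMap.add_apply,
      ContinuousAlternatingMap.smul_apply, wedge_apply, _root_.neg_apply, smul_eq_mul]
    rw [← Finset.sum_neg_distrib, ← Finset.sum_sub_distrib]
    exact Finset.sum_congr rfl fun A _ ↦ by ring
  have h2 : (∑ K, wedge (∑ A, P K A • w A) (θ K)) v =
      ∑ K, ((∑ A, P K A * w A (v 0)) * (dX K (v 1) - ∑ B, ξ K B * w B (v 1)) -
        (∑ A, P K A * w A (v 1)) * (dX K (v 0) - ∑ B, ξ K B * w B (v 0))) := by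
    simp only [hθ, ContinuousAlternatingMap.sum_apply, wedge_apply, _root_.sum_apply,
      _root_.sub_apply, _root_.smul_apply, smul_eq_mul]
  have h3 : ∀ u, ∀ A, df A u = ∑ K, P K A * dX K u := fun u A ↦ by
    simp only [hdf, _root_.sum_apply, _root_.smul_apply, smul_eq_mul]
  rw [h1, h2]
  simp only [h3]
  generalize hx : (fun K ↦ dX K (v 0)) = x
  generalize hy : (fun K ↦ dX K (v 1)) = y
  generalize hs : (fun K ↦ w K (v 0)) = s
  generalize ht : (fun K ↦ w K (v 1)) = t
  simp only [funext_iff] at hx hy hs ht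
  simp only [hx, hy, hs, ht]
  have e1 : ∀ p : κ → ℝ, ∀ t : ι → ℝ, ∑ A, (∑ K, P K A * p K) * t A =
      ∑ K, (∑ A, P K A * t A) * p K := fun p t ↦ by
    simp only [Finset.sum_mul]
    rw [Finset.sum_comm]
    exact Finset.sum_congr rfl fun K _ ↦ Finset.sum_congr rfl fun A _ ↦ by ring
  have e2 : ∀ s t : ι → ℝ, ∑ K, (∑ A, P K A * s A) * ∑ B, ξ K B * t B =
      ∑ B, ∑ C, (∑ K, ξ K B * P K C) * (t B * s C) := fun s t ↦ by
    simp only [Finset.sum_mul_sum]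
    simp only [Finset.sum_mul]
    rw [Finset.sum_comm]
    conv_rhs => rw [Finset.sum_comm]
    refine Finset.sum_congr rfl fun A _ ↦ ?_
    rw [Finset.sum_comm]
    exact Finset.sum_congr rfl fun B _ ↦ Finset.sum_congr rfl fun K _ ↦ by ring
  have e3 : ∑ A, g A * ((1 / 2 : ℝ) * ∑ B, ∑ C, c A B C * (s B * t C - t B * s C)) =
      (1 / 2 : ℝ) * ∑ B, ∑ C, (∑ A, g A * c A B C) * (s B * t C - t B * s C) := by
    simp only [Finset.sum_mul, Finset.mul_sum]
    rw [Finset.sum_comm]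
    refine Finset.sum_congr rfl fun B _ ↦ ?_
    rw [Finset.sum_comm]
    exact Finset.sum_congr rfl fun C _ ↦ Finset.sum_congr rfl fun A _ ↦ by ring
  have e4 : ∀ B C, ∑ A, g A * c A B C = ∑ K, ξ K C * P K B - ∑ K, ξ K B * P K C :=
    fun B C ↦ by linarith [hc B C]
  rw [e3]
  simp only [e4]
  have e5 : ∀ Q : ι → ι → ℝ, ∑ B, ∑ C, (Q C B - Q B C) * (s B * t C - t B * s C) =
      2 * ∑ B, ∑ C, Q B C * (t B * s C) - 2 * ∑ B, ∑ C, Q B C * (s B * t C) := fun Q ↦ by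
    have e6 : ∀ s t : ι → ℝ, ∑ B, ∑ C, Q C B * (s B * t C) = ∑ B, ∑ C, Q B C * (t B * s C) :=
      fun s t ↦ by
        rw [Finset.sum_comm]
        exact Finset.sum_congr rfl fun B _ ↦ Finset.sum_congr rfl fun C _ ↦ by ring
    simp only [sub_mul, mul_sub, Finset.sum_sub_distrib, e6]
    ring
  rw [e5 fun B C ↦ ∑ K, ξ K B * P K C]
  simp only [Finset.sum_sub_distrib, mul_sub, e1, e2]
  ring

end Wedge

section RepresentationForm

variable {E : Type*} [NormedAddCommGroup E] [NormedSpace ℝ E] [FiniteDimensional ℝ E]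
  {G : Type*} [TopologicalSpace G] [ChartedSpace E G] [Group G] [LieGroup 𝓘(ℝ, E) ∞ G]
  {r N : ℕ} (b : Module.Basis (Fin r) ℝ (GroupLieAlgebra 𝓘(ℝ, E) G))
  (U : TopologicalSpace.Opens (EuclideanSpace ℝ (Fin N)))

variable {U} in
theorem contMDiff_coe_snd : ContMDiff (𝓘(ℝ, E).prod 𝓘(ℝ, EuclideanSpace ℝ (Fin N)))
    𝓘(ℝ, EuclideanSpace ℝ (Fin N)) ∞ (fun q : G × U ↦ (q.2 : EuclideanSpace ℝ (Fin N))) :=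
  contMDiff_subtype_val.comp contMDiff_snd

variable {U} in
theorem contMDiff_comp_coe_snd {f : EuclideanSpace ℝ (Fin N) → ℝ} (hf : ContDiffOn ℝ ∞ f U) :
    ContMDiff (𝓘(ℝ, E).prod 𝓘(ℝ, EuclideanSpace ℝ (Fin N))) 𝓘(ℝ, ℝ) ∞
      (fun q : G × U ↦ f q.2) :=
  hf.contMDiffOn.comp_contMDiff contMDiff_coe_snd fun q ↦ q.2.2

theorem contDiff_coord (K : Fin N) : ContDiff ℝ ∞ (fun X : EuclideanSpace ℝ (Fin N) ↦ X K) :=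
  (EuclideanSpace.proj K : EuclideanSpace ℝ (Fin N) →L[ℝ] ℝ).contDiff

variable {U} in
theorem differential_comp_coe_snd {f : EuclideanSpace ℝ (Fin N) → ℝ} (hf : ContDiffOn ℝ ∞ f U)
    (p : G × U) :
    differential (I := 𝓘(ℝ, E).prod 𝓘(ℝ, EuclideanSpace ℝ (Fin N))) (fun q : G × U ↦ f q.2) p =
      ∑ K, partialDeriv K f p.2 • differential
        (I := 𝓘(ℝ, E).prod 𝓘(ℝ, EuclideanSpace ℝ (Fin N)))
        (fun q : G × U ↦ (q.2 : EuclideanSpace ℝ (Fin N)) K) p := by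
  set J := 𝓘(ℝ, E).prod 𝓘(ℝ, EuclideanSpace ℝ (Fin N))
  set D := mfderiv J 𝓘(ℝ, EuclideanSpace ℝ (Fin N))
    (fun q : G × U ↦ (q.2 : EuclideanSpace ℝ (Fin N))) p
  have h1 : ∀ f : EuclideanSpace ℝ (Fin N) → ℝ, DifferentiableAt ℝ f p.2 →
      ∀ u : TangentSpace J p,
        differential (I := J) (fun q : G × U ↦ f q.2) p u = fderiv ℝ f p.2 (D u) := by
    intro f hf u
    have h := mfderiv_comp p hf.mdifferentiableAt
      ((contMDiff_coe_snd (E := E) (G := G) (U := U)).mdifferentiableAt (by simp))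
    refine (DFunLike.congr_fun h u).trans ?_
    exact DFunLike.congr_fun mfderiv_eq_fderiv _
  refine ContinuousLinearMap.ext fun u ↦ ?_
  have h2 : ∀ K, differential (I := J) (fun q : G × U ↦ (q.2 : EuclideanSpace ℝ (Fin N)) K) p u =
      (show EuclideanSpace ℝ (Fin N) from D u) K := fun K ↦ by
    refine (h1 (fun X ↦ X K) ((contDiff_coord K).differentiable (by simp) _) u).trans ?_
    exact DFunLike.congr_fun (EuclideanSpace.proj K :
      EuclideanSpace ℝ (Fin N) →L[ℝ] ℝ).fderiv _
  have h3 : ∀ (L : EuclideanSpace ℝ (Fin N) →L[ℝ] ℝ) (Y : EuclideanSpace ℝ (Fin N)),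
      L Y = ∑ K, L (EuclideanSpace.single K 1) * Y K := fun L Y ↦ by
    conv_lhs => rw [← (EuclideanSpace.basisFun (Fin N) ℝ).sum_repr Y]
    simp [mul_comm]
  have hfd : DifferentiableAt ℝ f p.2 :=
    (hf.contDiffAt (U.isOpen.mem_nhds p.2.2)).differentiableAt (by simp)
  refine (h1 f hfd u).trans ?_
  refine (h3 _ _).trans ?_
  rw [_root_.sum_apply]
  exact Finset.sum_congr rfl fun K _ ↦ congrArg _ (h2 K).symm

theorem extd_pullback_fst_invariantForm (A : Fin r) (p : G × U) :
    extd (pullback (I' := 𝓘(ℝ, E).prod 𝓘(ℝ, EuclideanSpace ℝ (Fin N)))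
      (Prod.fst : G × U → G) (invariantForm b A)) p =
    (1 / 2 : ℝ) • ∑ B, ∑ C, structureConstant b A B C •
      wedge (pullback (I' := 𝓘(ℝ, E).prod 𝓘(ℝ, EuclideanSpace ℝ (Fin N)))
          (Prod.fst : G × U → G) (invariantForm b B) p)
        (pullback (I' := 𝓘(ℝ, E).prod 𝓘(ℝ, EuclideanSpace ℝ (Fin N)))
          (Prod.fst : G × U → G) (invariantForm b C) p) := by
  refine ContinuousAlternatingMap.ext fun v ↦ ?_
  refine (extd_pullback_fst (isSmooth_invariantForm b A) p v).trans ?_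
  rw [extd_invariantForm]
  refine (half_smul_sum_smul_apply _ _ _).trans ?_
  refine Eq.trans ?_ (half_smul_sum_smul_apply _ _ _).symm
  have h1 : ∀ (B : Fin r) (u : TangentSpace (𝓘(ℝ, E).prod 𝓘(ℝ, EuclideanSpace ℝ (Fin N))) p),
      pullback (I' := 𝓘(ℝ, E).prod 𝓘(ℝ, EuclideanSpace ℝ (Fin N)))
          (Prod.fst : G × U → G) (invariantForm b B) p u = invariantForm b B p.1 u.1 := by
    intro B u
    rw [pullback, mfderiv_fst]
    rfl
  have h2 : ∀ B C, wedge (invariantForm b B p.1) (invariantForm b C p.1) (fun i ↦ (v i).1) =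
      wedge (pullback (I' := 𝓘(ℝ, E).prod 𝓘(ℝ, EuclideanSpace ℝ (Fin N)))
          (Prod.fst : G × U → G) (invariantForm b B) p)
        (pullback (I' := 𝓘(ℝ, E).prod 𝓘(ℝ, EuclideanSpace ℝ (Fin N)))
          (Prod.fst : G × U → G) (invariantForm b C) p) v := by
    intro B C
    refine (wedge_apply _ _ _).trans (Eq.trans ?_ (wedge_apply _ _ _).symm)
    rw [h1, h1, h1, h1]
  exact congrArg _ (Finset.sum_congr rfl fun B _ ↦ Finset.sum_congr rfl fun C _ ↦
    congrArg _ (h2 B C))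

variable {ξ : Fin N → Fin r → EuclideanSpace ℝ (Fin N) → ℝ}

theorem representationForm_eq (J : Fin N) : representationForm b U ξ J = fun p ↦
    differential (fun q : G × U ↦ (q.2 : EuclideanSpace ℝ (Fin N)) J) p +
      ∑ A, (-ξ J A p.2) • pullback (Prod.fst : G × U → G) (invariantForm b A) p := by
  funext p
  exact sub_sum_smul _ _ _

variable {U}

theorem isSmooth_differential_coord (J : Fin N) :
    IsSmooth (differential (I := 𝓘(ℝ, E).prod 𝓘(ℝ, EuclideanSpace ℝ (Fin N)))
      (fun q : G × U ↦ (q.2 : EuclideanSpace ℝ (Fin N)) J)) := by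
  exact isSmooth_differential (contMDiff_comp_coe_snd (contDiff_coord J).contDiffOn)

theorem isSmooth_pullback_invariantForm (A : Fin r) :
    IsSmooth (pullback (I' := 𝓘(ℝ, E).prod 𝓘(ℝ, EuclideanSpace ℝ (Fin N)))
      (Prod.fst : G × U → G) (invariantForm b A)) := by
  exact isSmooth_pullback_fst (isSmooth_invariantForm b A)

theorem isSmooth_representationForm (hξ : ∀ J A, ContDiffOn ℝ ∞ (ξ J A) U) (J : Fin N) :
    IsSmooth (representationForm b U ξ J) := by
  rw [representationForm_eq]
  exact (isSmooth_differential_coord J).add (IsSmooth.sum fun A _ ↦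
    (isSmooth_pullback_invariantForm b A).smul (contMDiff_comp_coe_snd (hξ J A).neg))

theorem extd_representationForm (hξ : ∀ J A, ContDiffOn ℝ ∞ (ξ J A) U)
    (hLie : ∀ X ∈ U, ∀ (J : Fin N) (B C : Fin r),
        ∑ K, ξ K B X * partialDeriv K (ξ J C) X - ∑ K, ξ K C X * partialDeriv K (ξ J B) X +
          ∑ A, ξ J A X * structureConstant b A B C = 0) (J : Fin N) (p : G × U) :
    extd (representationForm b U ξ J) p =
      ∑ K, wedge (∑ A, partialDeriv K (ξ J A) p.2 •
        pullback (Prod.fst : G × U → G) (invariantForm b A) p) (representationForm b U ξ K p) := by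
  have hw := isSmooth_pullback_invariantForm (U := U) b
  have hf : ∀ A, ContMDiff (𝓘(ℝ, E).prod 𝓘(ℝ, EuclideanSpace ℝ (Fin N))) 𝓘(ℝ, ℝ) ∞
      (fun q : G × U ↦ -ξ J A q.2) := fun A ↦ contMDiff_comp_coe_snd (hξ J A).neg
  rw [representationForm_eq b U J, extd_add (isSmooth_differential_coord J)
    (IsSmooth.sum fun A _ ↦ (hw A).smul (hf A)),
    extd_differential (contMDiff_comp_coe_snd (contDiff_coord J).contDiffOn), zero_add,
    extd_sum fun A _ ↦ (hw A).smul (hf A)]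
  rw [← sum_wedge_sub_eq
    (fun K ↦ differential (fun q : G × U ↦ (q.2 : EuclideanSpace ℝ (Fin N)) K) p)
    (fun K ↦ representationForm b U ξ K p) _
    (fun A ↦ differential (fun q : G × U ↦ ξ J A q.2) p) (fun A ↦ ξ J A p.2)
    (fun K A ↦ ξ K A p.2) _ (structureConstant b) _ (fun K ↦ rfl)
    (fun A ↦ differential_comp_coe_snd (hξ J A) p)
    (fun A ↦ extd_pullback_fst_invariantForm b U A p) (hLie p.2 p.2.2 J)]
  refine Finset.sum_congr rfl fun A _ ↦ ?_
  rw [extd_smul (hf A) (hw A)]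
  have h : differential (I := 𝓘(ℝ, E).prod 𝓘(ℝ, EuclideanSpace ℝ (Fin N)))
      (fun q : G × U ↦ -ξ J A q.2) p = -differential (fun q : G × U ↦ ξ J A q.2) p :=
    mfderiv_neg
  rw [h]

theorem representationForm_mem_pfaffianSystem (J : Fin N) :
    representationForm b U ξ J ∈ pfaffianSystem (representationForm b U ξ) := by
  classical
  refine ⟨fun i _ ↦ if i = J then 1 else 0, fun i ↦ contMDiff_const, ?_⟩
  funext p
  simp

theorem completelyIntegrable_representationForm (hξ : ∀ J A, ContDiffOn ℝ ∞ (ξ J A) U)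
    (hLie : ∀ X ∈ U, ∀ (J : Fin N) (B C : Fin r),
        ∑ K, ξ K B X * partialDeriv K (ξ J C) X - ∑ K, ξ K C X * partialDeriv K (ξ J B) X +
          ∑ A, ξ J A X * structureConstant b A B C = 0) :
    CompletelyIntegrable (pfaffianSystem (representationForm b U ξ)) := by
  have hθ := isSmooth_representationForm b hξ
  refine ⟨?_, ?_⟩
  · rintro _ ⟨f, hf, rfl⟩
    exact IsSmooth.sum fun J _ ↦ (hθ J).smul (hf J)
  rintro _ ⟨f, hf, rfl⟩
  have hP : ∀ J A K, ContMDiff (𝓘(ℝ, E).prod 𝓘(ℝ, EuclideanSpace ℝ (Fin N))) 𝓘(ℝ, ℝ) ∞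
      (fun q : G × U ↦ partialDeriv K (ξ J A) q.2) := fun J A K ↦
    contMDiff_comp_coe_snd (f := partialDeriv K (ξ J A))
      (((hξ J A).fderiv_of_isOpen U.isOpen (by simp)).clm_apply contDiffOn_const)
  refine ⟨N, fun K p ↦ differential (f K) p + ∑ J, f J p • ∑ A,
    partialDeriv K (ξ J A) p.2 • pullback (Prod.fst : G × U → G) (invariantForm b A) p,
    representationForm b U ξ, fun K ↦ ?_, representationForm_mem_pfaffianSystem b, fun p ↦ ?_⟩
  · exact (isSmooth_differential (hf K)).add (IsSmooth.sum fun J _ ↦ IsSmooth.smul (hf J)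
      (IsSmooth.sum fun A _ ↦ (isSmooth_pullback_invariantForm b A).smul (hP J A K)))
  rw [extd_sum fun J _ ↦ (hθ J).smul (hf J)]
  have h1 : ∀ J, extd (fun q ↦ f J q • representationForm b U ξ J q) p =
      wedge (differential (f J) p) (representationForm b U ξ J p) + f J p • ∑ K, wedge (∑ A,
        partialDeriv K (ξ J A) p.2 • pullback (Prod.fst : G × U → G) (invariantForm b A) p)
        (representationForm b U ξ K p) := fun J ↦ by
    rw [extd_smul (hf J) (hθ J), extd_representationForm b hξ hLie]
  exact (Finset.sum_congr rfl fun J _ ↦ h1 J).trans (sum_wedge_add_smul _ _ _ _)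

end RepresentationForm

end Pfaffian

end

theorem theorem4p1
    {E : Type*} [NormedAddCommGroup E] [NormedSpace ℝ E] [FiniteDimensional ℝ E]
    {G : Type*} [TopologicalSpace G] [ChartedSpace E G] [Group G] [LieGroup 𝓘(ℝ, E) ∞ G]
    {r N : ℕ} (b : Module.Basis (Fin r) ℝ (GroupLieAlgebra 𝓘(ℝ, E) G))
    (U : TopologicalSpace.Opens (EuclideanSpace ℝ (Fin N)))
    (ξ : Fin N → Fin r → EuclideanSpace ℝ (Fin N) → ℝ)
    (hξ : ∀ J A, ContDiffOn ℝ ∞ (ξ J A) U) :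
    (∀ (A : Fin r) (a : G), Pfaffian.extd (Pfaffian.invariantForm b A) a =
      (1 / 2 : ℝ) • ∑ B, ∑ C, Pfaffian.structureConstant b A B C •
        Pfaffian.wedge (Pfaffian.invariantForm b B a) (Pfaffian.invariantForm b C a)) ∧
    ((∀ X ∈ U, ∀ (J : Fin N) (B C : Fin r),
        ∑ K, ξ K B X * Pfaffian.partialDeriv K (ξ J C) X -
          ∑ K, ξ K C X * Pfaffian.partialDeriv K (ξ J B) X +
          ∑ A, ξ J A X * Pfaffian.structureConstant b A B C = 0) →
      Pfaffian.CompletelyIntegrable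
        (Pfaffian.pfaffianSystem (Pfaffian.representationForm b U ξ))) :=
  ⟨Pfaffian.extd_invariantForm b, Pfaffian.completelyIntegrable_representationForm b hξ⟩
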